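/- Let $\mathbb D$ be the open unit disc in $\mathbb C$, and let $H^2$ be the Hardy space of all holomorphic functions $f$ on $\mathbb D$ with $\|f\|_2=\sup_{0\le r<1}\big(\frac1{2\pi}\int_0^{2\pi}|f(re^{it})|^2\,dt\big)^{1/2}<\infty$. Let $\varphi:\mathbb D\to\mathbb D$ be a holomorphic self-map of $\mathbb D$, with composition operator $C_\varphi f=f\circ\varphi$, and let $\theta$ be an inner function, that is, $\theta$ is holomorphic on $\mathbb D$, $|\theta|\le 1$ on $\mathbb D$, and for almost every $t$ the radial limit $\lim_{r\to1^-}\theta(re^{it})$ exists and has modulus $1$. Write $\theta H^2=\{\theta g: g\in H^2\}$ and let $K(z,w)=(1-z\bar w)^{-1}$ $(z,w\in\mathbb D)$ be the Szegő kernel. Then the following statements are equivalent: (a) $C_\varphi(\theta H^2)\subseteq\theta H^2$. (b) The map $\overline{\theta(w)}\,K(\cdot,w)\mapsto\overline{\theta(\varphi(w))}\,K(\cdot,\varphi(w))$ $(w\in\mathbb D)$ extends to a bounded linear operator on $H^2$; that is, there is a bounded linear operator $A$ on $H^2$ with $A\big(\overline{\theta(w)}\,K(\cdot,w)\big)=\overline{\theta(\varphi(w))}\,K(\cdot,\varphi(w))$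 for all $w\in\mathbb D$. (c) $(\theta\circ\varphi)/\theta$ is a Schur function; that is, there is a holomorphic function $\psi$ on $\mathbb D$ with $|\psi|\le1$ on $\mathbb D$ and $\psi(z)=\theta(\varphi(z))/\theta(z)$ for all $z\in\mathbb D$ with $\theta(z)\ne0$. -/

import Mathlib

open scoped Complex.UnitDisc ComplexConjugate Topology

noncomputable section

namespace HardyDisc

/-- The extension by zero to `ℂ` of a function on the open unit disc `𝔻`. -/
def ext (f : 𝔻 → ℂ) : ℂ → ℂ :=
  Function.extend (fun z : 𝔻 => (z : ℂ)) f 0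

/-- `f : 𝔻 → ℂ` is holomorphic on the open unit disc. -/
def Holo (f : 𝔻 → ℂ) : Prop :=
  DifferentiableOn ℂ (ext f) (Metric.ball 0 1)

/-- The quadratic mean `((2π)⁻¹ ∫₀^{2π} |f (r e^{it})|² dt)^{1/2}` over the circle of radius `r`. -/
def circleMean (f : 𝔻 → ℂ) (r : ℝ) : ℝ :=
  √(Real.circleAverage (fun z => ‖ext f z‖ ^ 2) 0 r)

/-- The Hardy norm `‖f‖₂ = sup_{0 ≤ r < 1} ((2π)⁻¹ ∫₀^{2π} |f (r e^{it})|² dt)^{1/2}`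
(meaningful when the supremum is finite, as it is for members of `H2`). -/
def hardyNorm (f : 𝔻 → ℂ) : ℝ :=
  ⨆ r : Set.Ico (0 : ℝ) 1, circleMean f r

lemma ext_coe (f : 𝔻 → ℂ) (z : 𝔻) : ext f (z : ℂ) = f z :=
  Complex.UnitDisc.coe_injective.extend_apply f 0 z

lemma ext_of_norm_lt (f : 𝔻 → ℂ) {z : ℂ} (hz : ‖z‖ < 1) :
    ext f z = f (Complex.UnitDisc.mk z hz) :=
  ext_coe f (Complex.UnitDisc.mk z hz)

lemma holo_of_eqOn {f : 𝔻 → ℂ} {F : ℂ → ℂ} (hF : DifferentiableOn ℂ F (Metric.ball 0 1))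
    (h : ∀ z : 𝔻, f z = F z) : Holo f := by
  refine hF.congr fun z hz => ?_
  rw [ext_of_norm_lt f (mem_ball_zero_iff.1 hz), h]
  rfl

lemma ext_add (f g : 𝔻 → ℂ) {z : ℂ} (hz : ‖z‖ < 1) : ext (f + g) z = ext f z + ext g z := by
  simp [ext_of_norm_lt _ hz]

lemma ext_smul (c : ℂ) (f : 𝔻 → ℂ) {z : ℂ} (hz : ‖z‖ < 1) : ext (c • f) z = c * ext f z := by
  simp [ext_of_norm_lt _ hz]

lemma norm_lt_of_mem_sphere {r : ℝ} (hr : r ∈ Set.Ico (0 : ℝ) 1) {z : ℂ}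
    (hz : z ∈ Metric.sphere (0 : ℂ) |r|) : ‖z‖ < 1 := by
  rw [mem_sphere_zero_iff_norm.1 hz, abs_of_nonneg hr.1]
  exact hr.2

lemma Holo.circleIntegrable {f : 𝔻 → ℂ} (hf : Holo f) {r : ℝ} (hr : r ∈ Set.Ico (0 : ℝ) 1) :
    CircleIntegrable (fun z => ‖ext f z‖ ^ 2) 0 r := by
  refine ContinuousOn.circleIntegrable hr.1 ((hf.continuousOn.mono fun z hz => ?_).norm.pow 2)
  exact mem_ball_zero_iff.2 (norm_lt_of_mem_sphere hr (by rwa [abs_of_nonneg hr.1]))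

lemma circleMean_le {f : 𝔻 → ℂ} (hf : Holo f) {r : ℝ} (hr : r ∈ Set.Ico (0 : ℝ) 1) {M : ℝ}
    (hM : ∀ z, ‖f z‖ ≤ M) : circleMean f r ≤ M := by
  have hM0 : 0 ≤ M := (norm_nonneg _).trans (hM (Complex.UnitDisc.mk 0 (by simp)))
  refine Real.sqrt_le_iff.2 ⟨hM0, ?_⟩
  refine Real.circleAverage_mono_on_of_le_circle (hf.circleIntegrable hr) fun z hz => ?_
  rw [ext_of_norm_lt f (norm_lt_of_mem_sphere hr hz)]
  exact pow_le_pow_left₀ (norm_nonneg _) (hM _) 2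

lemma circleMean_add_le {f g : 𝔻 → ℂ} (hf : Holo f) (hg : Holo g) (hfg : Holo (f + g)) {r : ℝ}
    (hr : r ∈ Set.Ico (0 : ℝ) 1) {M N : ℝ} (hM : circleMean f r ≤ M) (hN : circleMean g r ≤ N) :
    circleMean (f + g) r ≤ √(2 * M ^ 2 + 2 * N ^ 2) := by
  refine Real.sqrt_le_sqrt ?_
  have h1 : Real.circleAverage (fun z => ‖ext f z‖ ^ 2) 0 r ≤ M ^ 2 := (Real.sqrt_le_iff.1 hM).2
  have h2 : Real.circleAverage (fun z => ‖ext g z‖ ^ 2) 0 r ≤ N ^ 2 := (Real.sqrt_le_iff.1 hN).2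
  have i1 := (hf.circleIntegrable hr).const_smul (a := (2 : ℝ))
  have i2 := (hg.circleIntegrable hr).const_smul (a := (2 : ℝ))
  have key := Real.circleAverage_mono (hfg.circleIntegrable hr) (i1.add i2) (fun z hz => by
    have : ext (f + g) z = ext f z + ext g z := ext_add f g (norm_lt_of_mem_sphere hr hz)
    simp only [Pi.add_apply, Pi.smul_apply, smul_eq_mul, this]
    have := norm_add_le (ext f z) (ext g z)
    nlinarith [norm_nonneg (ext f z + ext g z), sq_nonneg (‖ext f z‖ - ‖ext g z‖)])
  rw [Real.circleAverage_add i1 i2, Real.circleAverage_smul, Real.circleAverage_smul] at key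
  simp only [smul_eq_mul] at key
  linarith

lemma circleMean_smul (c : ℂ) (f : 𝔻 → ℂ) {r : ℝ} (hr : r ∈ Set.Ico (0 : ℝ) 1) :
    circleMean (c • f) r = ‖c‖ * circleMean f r := by
  have : Real.circleAverage (fun z => ‖ext (c • f) z‖ ^ 2) 0 r =
      Real.circleAverage ((‖c‖ ^ 2) • fun z => ‖ext f z‖ ^ 2) 0 r := by
    refine Real.circleAverage_congr_sphere fun z hz => ?_
    simp [ext_smul c f (norm_lt_of_mem_sphere hr hz), mul_pow]
  rw [circleMean, circleMean, this, Real.circleAverage_smul, smul_eq_mul,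
    Real.sqrt_mul (by positivity), Real.sqrt_sq (norm_nonneg _)]

lemma Holo.add {f g : 𝔻 → ℂ} (hf : Holo f) (hg : Holo g) : Holo (f + g) :=
  holo_of_eqOn (DifferentiableOn.add hf hg) fun z => by simp [ext_coe]

lemma Holo.smul (c : ℂ) {f : 𝔻 → ℂ} (hf : Holo f) : Holo (c • f) :=
  holo_of_eqOn (DifferentiableOn.const_smul hf c) fun z => by simp [ext_coe]

/-- The Hardy space `H²`: the holomorphic functions on `𝔻` whose quadratic means over the circles
of radius `0 ≤ r < 1` are bounded, that is, with `‖f‖₂ < ∞`. -/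
def H2 : Submodule ℂ (𝔻 → ℂ) where
  carrier := {f | Holo f ∧ BddAbove (Set.range fun r : Set.Ico (0 : ℝ) 1 => circleMean f r)}
  add_mem' := by
    rintro f g ⟨hf, M, hM⟩ ⟨hg, N, hN⟩
    refine ⟨hf.add hg, √(2 * M ^ 2 + 2 * N ^ 2), ?_⟩
    rintro _ ⟨r, rfl⟩
    exact circleMean_add_le hf hg (hf.add hg) r.2 (hM ⟨r, rfl⟩) (hN ⟨r, rfl⟩)
  zero_mem' := by
    have h0 : Holo 0 := holo_of_eqOn (differentiableOn_const (0 : ℂ)) fun z => rfl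
    refine ⟨h0, 0, ?_⟩
    rintro _ ⟨r, rfl⟩
    exact circleMean_le h0 r.2 fun z => by simp
  smul_mem' := by
    rintro c f ⟨hf, M, hM⟩
    refine ⟨hf.smul c, ‖c‖ * M, ?_⟩
    rintro _ ⟨r, rfl⟩
    simp only [circleMean_smul c f r.2]
    exact mul_le_mul_of_nonneg_left (hM ⟨r, rfl⟩) (norm_nonneg c)

lemma one_sub_ne_zero (z w : 𝔻) : 1 - (z : ℂ) * conj (w : ℂ) ≠ 0 := by
  intro h
  have h1 : ‖(z : ℂ) * conj (w : ℂ)‖ = 1 := by rw [← sub_eq_zero.1 h, norm_one]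
  rw [norm_mul, RCLike.norm_conj] at h1
  nlinarith [z.norm_lt_one, w.norm_lt_one, norm_nonneg (z : ℂ), norm_nonneg (w : ℂ)]

/-- The Szegő kernel `K(z, w) = (1 - z w̄)⁻¹`. -/
def szego (z w : 𝔻) : ℂ := (1 - (z : ℂ) * conj (w : ℂ))⁻¹

lemma szego_mem (w : 𝔻) : (fun z => szego z w) ∈ H2 := by
  have hh : Holo fun z => szego z w := by
    refine holo_of_eqOn (F := fun z => (1 - z * conj (w : ℂ))⁻¹) ?_ fun z => rfl
    refine DifferentiableOn.inv (by fun_prop) fun z hz => ?_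
    exact one_sub_ne_zero (Complex.UnitDisc.mk z (mem_ball_zero_iff.1 hz)) w
  refine ⟨hh, (1 - ‖(w : ℂ)‖)⁻¹, ?_⟩
  rintro _ ⟨r, rfl⟩
  refine circleMean_le hh r.2 fun z => ?_
  rw [szego, norm_inv]
  have hw := w.norm_lt_one
  refine inv_anti₀ (by linarith) ?_
  have h := norm_sub_norm_le (1 : ℂ) ((z : ℂ) * conj (w : ℂ))
  rw [norm_one, norm_mul, RCLike.norm_conj] at h
  nlinarith [z.norm_lt_one, norm_nonneg (w : ℂ)]

/-- The kernel function `K(·, w)` as an element of `H²`. -/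
def kernelFun (w : 𝔻) : H2 := ⟨fun z => szego z w, szego_mem w⟩

/-- A bounded linear operator on `H²`. -/
def IsBoundedOp (T : H2 →ₗ[ℂ] H2) : Prop :=
  ∃ C : ℝ, ∀ f : H2, hardyNorm (T f : 𝔻 → ℂ) ≤ C * hardyNorm (f : 𝔻 → ℂ)

/-- The Schur class `S(𝔻)`: holomorphic functions on `𝔻` bounded by one in modulus. -/
def schurClass : Set (𝔻 → ℂ) := {f | Holo f ∧ ∀ z, ‖f z‖ ≤ 1}

/-- Inner functions: holomorphic, bounded by one in modulus on `𝔻`, with radial limits that are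
of modulus one at almost every boundary point `e^{it}`. -/
structure IsInner (θ : 𝔻 → ℂ) : Prop where
  holo : Holo θ
  norm_le_one : ∀ z, ‖θ z‖ ≤ 1
  radial_limit : ∀ᵐ t : ℝ, ∃ c : ℂ, ‖c‖ = 1 ∧
    Filter.Tendsto (fun r : ℝ => ext θ (r * Complex.exp (t * Complex.I))) (𝓝[<] 1) (𝓝 c)

/-- The subset `θ H² = {θ g : g ∈ H²}`. -/
def mulH2 (θ : 𝔻 → ℂ) : Set (𝔻 → ℂ) := (fun g => θ * g) '' (H2 : Set (𝔻 → ℂ))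

/-- The composition operator `C_φ f = f ∘ φ`. -/
def compOp (φ : 𝔻 → 𝔻) (f : 𝔻 → ℂ) : 𝔻 → ℂ := f ∘ φ

end HardyDisc

end

noncomputable section

namespace HardyDisc

/-! ### Circle averages -/

/-! Taylor coefficients identify `H2` isometrically with ℓ², where adjoints exist and evaluation at
`w` is the inner product with `kernelSeq w`. (a) ⇒ (c): θ = θ·1 lies in θH², so θ∘φ = θg with g in
H². That |g| ≤ 1 is `IsInner.norm_le_one_of_mul`, which rests on `IsInner.norm_le`: multiplication
by an inner function does not shrink norms. (c) ⇒ (b): Tf = ψ·(f∘φ) is bounded by Littlewood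
subordination (`circleMean_powerSum_comp_le`), and T* sends K_w to conj ψ(w) K_{φ(w)}; multiply by
conj θ(w) and use ψθ = θ∘φ. (b) ⇒ (a): pairing A*g with conj θ(w) K_w gives θ·A*g = (θg)∘φ. Boundary
values are needed for θ only: norms are compared first for absolutely summable coefficients, then by
density. -/

/-- Dominated convergence for quadratic means over the unit circle. -/
lemma tendsto_circleAverage_sq {ι : Type*} {l : Filter ι} [l.IsCountablyGenerated]
    {F : ι → ℂ → ℂ} {G : ℂ → ℂ} {M : ℝ}
    (hF : ∀ᶠ i in l, ContinuousOn (F i) (Metric.sphere 0 1))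
    (hM : ∀ᶠ i in l, ∀ z ∈ Metric.sphere (0 : ℂ) 1, ‖F i z‖ ≤ M)
    (hG : ∀ᵐ t : ℝ,
      Filter.Tendsto (fun i => ‖F i (circleMap 0 1 t)‖) l (𝓝 ‖G (circleMap 0 1 t)‖)) :
    Filter.Tendsto (fun i => Real.circleAverage (fun z => ‖F i z‖ ^ 2) 0 1) l
      (𝓝 (Real.circleAverage (fun z => ‖G z‖ ^ 2) 0 1)) := by
  have hmem : ∀ t : ℝ, circleMap 0 1 t ∈ Metric.sphere (0 : ℂ) 1 := fun t =>
    circleMap_mem_sphere 0 zero_le_one t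
  refine Filter.Tendsto.const_smul ?_ _
  refine intervalIntegral.tendsto_integral_filter_of_dominated_convergence (fun _ => M ^ 2)
    ?_ ?_ intervalIntegrable_const ?_
  · filter_upwards [hF] with i hi
    have : Continuous fun t : ℝ => F i (circleMap 0 1 t) :=
      hi.comp_continuous (continuous_circleMap 0 1) hmem
    exact (this.norm.pow 2).aestronglyMeasurable
  · filter_upwards [hM] with i hi
    refine Filter.Eventually.of_forall fun t _ => ?_
    rw [norm_pow, norm_norm]
    exact pow_le_pow_left₀ (norm_nonneg _) (hi _ (hmem t)) 2
  · filter_upwards [hG] with t ht _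
    exact ht.pow 2

/-- Parseval's identity for absolutely convergent power series on the unit circle. -/
lemma hasSum_sq_circleAverage {b : ℕ → ℂ} (hb : Summable fun n => ‖b n‖) :
    HasSum (fun n => ‖b n‖ ^ 2)
      (Real.circleAverage (fun z => ‖∑' n, b n * z ^ n‖ ^ 2) 0 1) := by
  have hz : ∀ z ∈ Metric.sphere (0 : ℂ) 1, ∀ n, ‖b n * z ^ n‖ = ‖b n‖ := fun z hz n => by
    rw [norm_mul, norm_pow, mem_sphere_zero_iff_norm.1 hz, one_pow, mul_one]
  rw [hasSum_iff_tendsto_nat_of_nonneg fun n => sq_nonneg _]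
  -- The partial sums are polynomials, where Parseval is known; dominated convergence does the rest.
  have key : ∀ N : ℕ, Real.circleAverage
      (fun z => ‖∑ n ∈ Finset.range N, b n * z ^ n‖ ^ 2) 0 1 =
      ∑ n ∈ Finset.range N, ‖b n‖ ^ 2 := fun N => by
    set p : Polynomial ℂ := ∑ n ∈ Finset.range N, Polynomial.monomial n (b n) with hp
    have hcoeff : ∀ n, p.coeff n = if n < N then b n else 0 := fun n => by
      simp [hp, Polynomial.finsetSum_coeff, Polynomial.coeff_monomial]
    have h1 := Polynomial.sum_sq_norm_coeff_eq_circleAverage p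
    have h2 : (fun z => ‖p.eval z‖ ^ 2) =
        fun z => ‖∑ n ∈ Finset.range N, b n * z ^ n‖ ^ 2 := by
      ext z; simp [hp, Polynomial.eval_finsetSum]
    rw [h2] at h1
    rw [← h1, Finset.sum_subset (s₁ := p.support) (s₂ := Finset.range N)]
    · exact Finset.sum_congr rfl fun n hn => by rw [hcoeff, if_pos (Finset.mem_range.1 hn)]
    · intro n hn
      by_contra h
      exact Polynomial.mem_support_iff.1 hn (by rw [hcoeff, if_neg (by simpa using h)])
    · intro n _ hn
      simp [Polynomial.notMem_support_iff.1 hn]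
  simp only [← key]
  refine tendsto_circleAverage_sq (M := ∑' n, ‖b n‖) (Filter.Eventually.of_forall fun N => ?_)
    (Filter.Eventually.of_forall fun N z h => ?_) (Filter.Eventually.of_forall fun t => ?_)
  · fun_prop
  · refine (norm_sum_le _ _).trans ?_
    simp only [hz z h]
    exact hb.sum_le_tsum _ fun n _ => norm_nonneg _
  · refine (HasSum.tendsto_sum_nat (Summable.hasSum ?_)).norm
    refine Summable.of_norm ?_
    simpa only [hz _ (circleMap_mem_sphere 0 zero_le_one t)] using hb

/-- Moving every circle to the unit circle turns `r` into a parameter of the integrand, so limits in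
`r` fall under dominated convergence. -/
lemma circleMean_sq (f : 𝔻 → ℂ) (r : ℝ) :
    circleMean f r ^ 2 = Real.circleAverage (fun z => ‖ext f (r * z)‖ ^ 2) 0 1 := by
  rw [circleMean, Real.sq_sqrt (Real.circleAverage_nonneg_of_nonneg fun z _ => sq_nonneg _),
    Real.circleAverage_eq_circleAverage_zero_one]
  simp

lemma circleMean_nonneg (f : 𝔻 → ℂ) (r : ℝ) : 0 ≤ circleMean f r := Real.sqrt_nonneg _

lemma norm_mul_lt_one {r : ℝ} (hr : r ∈ Set.Ico (0 : ℝ) 1) {z : ℂ}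
    (hz : z ∈ Metric.sphere (0 : ℂ) 1) : ‖(r : ℂ) * z‖ < 1 := by
  rw [norm_mul, mem_sphere_zero_iff_norm.1 hz, mul_one, Complex.norm_real, Real.norm_eq_abs,
    abs_of_nonneg hr.1]
  exact hr.2

lemma Holo.continuousOn_dilate {f : 𝔻 → ℂ} (hf : Holo f) {r : ℝ} (hr : r ∈ Set.Ico (0 : ℝ) 1) :
    ContinuousOn (fun z : ℂ => ext f (r * z)) (Metric.sphere 0 1) :=
  hf.continuousOn.comp (by fun_prop) fun _ hz => mem_ball_zero_iff.2 (norm_mul_lt_one hr hz)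

/-- Parseval's identity on the circle of radius `r`. -/
lemma hasSum_sq_circleMean {f : 𝔻 → ℂ} {a : ℕ → ℂ}
    (ha : ∀ z : 𝔻, HasSum (fun n => a n * z ^ n) (f z)) {r : ℝ} (hr : r ∈ Set.Ico (0 : ℝ) 1) :
    HasSum (fun n => (‖a n‖ * r ^ n) ^ 2) (circleMean f r ^ 2) := by
  have hn : ‖(r : ℂ)‖ < 1 := by simpa [abs_of_nonneg hr.1] using hr.2
  have hs : Summable fun n => ‖a n * (r : ℂ) ^ n‖ := (ha (Complex.UnitDisc.mk r hn)).summable.norm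
  have h := hasSum_sq_circleAverage hs
  rw [circleMean_sq]
  have : ∀ n, ‖a n * (r : ℂ) ^ n‖ = ‖a n‖ * r ^ n := fun n => by
    rw [norm_mul, norm_pow, Complex.norm_real, Real.norm_eq_abs, abs_of_nonneg hr.1]
  simp only [this] at h
  convert h using 1
  refine Real.circleAverage_congr_sphere fun z hz => ?_
  rw [abs_one] at hz
  rw [ext_of_norm_lt f (norm_mul_lt_one hr hz), ← (ha _).tsum_eq]
  simp [mul_pow, mul_assoc]

/-! ### Identification of `H²` with `ℓ²` -/

/-- The Hilbert space `ℓ²(ℕ)`. -/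
abbrev Ell2 : Type := lp (fun _ : ℕ => ℂ) 2

lemma Ell2.hasSum_sq (a : Ell2) : HasSum (fun n => ‖a n‖ ^ 2) (‖a‖ ^ 2) := by
  have := lp.hasSum_norm (p := 2) (by simp) a
  simpa using this

lemma memℓp_two {a : ℕ → ℂ} (h : Summable fun n => ‖a n‖ ^ 2) : Memℓp a 2 :=
  memℓp_gen (by simpa using h)

lemma Ell2.summable (a : Ell2) {z : ℂ} (hz : ‖z‖ < 1) : Summable fun n => a n * z ^ n := by
  refine Summable.of_norm_bounded ((summable_geometric_of_lt_one (norm_nonneg z) hz).mul_left ‖a‖)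
    fun n => ?_
  rw [norm_mul, norm_pow]
  exact mul_le_mul_of_nonneg_right (lp.norm_apply_le_norm (by simp) a n) (by positivity)

/-- The function on the disc with Taylor coefficients `a`. -/
def powerSum (a : Ell2) (z : 𝔻) : ℂ := ∑' n, a n * (z : ℂ) ^ n

lemma hasSum_powerSum (a : Ell2) (z : 𝔻) : HasSum (fun n => a n * (z : ℂ) ^ n) (powerSum a z) :=
  (a.summable z.norm_lt_one).hasSum

lemma holo_powerSum (a : Ell2) : Holo (powerSum a) := by
  refine holo_of_eqOn (F := fun z => ∑' n, a n * z ^ n) (fun z hz => ?_) fun z => rfl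
  obtain ⟨r, hzr, hr⟩ := exists_between (mem_ball_zero_iff.1 hz)
  have hr0 : 0 ≤ r := (norm_nonneg z).trans hzr.le
  have h : DifferentiableOn ℂ (fun z => ∑' n, a n * z ^ n) (Metric.ball 0 r) := by
    refine Complex.differentiableOn_tsum_of_summable_norm (u := fun n => ‖a‖ * r ^ n)
      ((summable_geometric_of_lt_one hr0 hr).mul_left ‖a‖) (fun n => by fun_prop)
      Metric.isOpen_ball fun n w hw => ?_
    rw [norm_mul, norm_pow]
    have hw' := (mem_ball_zero_iff.1 hw).le
    gcongr
    exact lp.norm_apply_le_norm (by simp) a n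
  exact (h.differentiableAt (Metric.isOpen_ball.mem_nhds
    (mem_ball_zero_iff.2 hzr))).differentiableWithinAt

lemma circleMean_powerSum_le (a : Ell2) {r : ℝ} (hr : r ∈ Set.Ico (0 : ℝ) 1) :
    circleMean (powerSum a) r ≤ ‖a‖ := by
  refine (abs_le_of_sq_le_sq' ?_ (norm_nonneg a)).2
  refine hasSum_le (fun n => ?_) (hasSum_sq_circleMean (hasSum_powerSum a) hr) a.hasSum_sq
  refine pow_le_pow_left₀ (mul_nonneg (norm_nonneg _) (pow_nonneg hr.1 n)) ?_ 2
  exact mul_le_of_le_one_right (norm_nonneg _) (pow_le_one₀ hr.1 hr.2.le)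

/-- A bound for the quadratic means bounds the sums of squares of Taylor coefficients. -/
lemma sum_sq_coeff_le {f : 𝔻 → ℂ} {b : ℕ → ℂ}
    (hb : ∀ z : 𝔻, HasSum (fun n => b n * (z : ℂ) ^ n) (f z)) {M : ℝ}
    (hM : ∀ r ∈ Set.Ico (0 : ℝ) 1, circleMean f r ≤ M) (s : Finset ℕ) :
    ∑ n ∈ s, ‖b n‖ ^ 2 ≤ M ^ 2 := by
  have h1 : ∀ r ∈ Set.Ico (0 : ℝ) 1, ∑ n ∈ s, (‖b n‖ * r ^ n) ^ 2 ≤ M ^ 2 := fun r hr =>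
    (sum_le_hasSum s (fun n _ => sq_nonneg _) (hasSum_sq_circleMean hb hr)).trans
      (pow_le_pow_left₀ (circleMean_nonneg f r) (hM r hr) 2)
  have h2 : Filter.Tendsto (fun r : ℝ => ∑ n ∈ s, (‖b n‖ * r ^ n) ^ 2) (𝓝[<] 1)
      (𝓝 (∑ n ∈ s, (‖b n‖ * 1 ^ n) ^ 2)) :=
    (Continuous.tendsto (by fun_prop) 1).mono_left nhdsWithin_le_nhds
  simp only [one_pow, mul_one] at h2
  refine le_of_tendsto h2 ?_
  filter_upwards [Ioo_mem_nhdsLT (zero_lt_one' ℝ)] with r hr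
  exact h1 r ⟨hr.1.le, hr.2⟩

lemma nonneg_of_circleMean_le {f : 𝔻 → ℂ} {M : ℝ}
    (hM : ∀ r ∈ Set.Ico (0 : ℝ) 1, circleMean f r ≤ M) : 0 ≤ M :=
  (circleMean_nonneg f 0).trans (hM 0 (by simp))

lemma norm_le_of_circleMean_le {a : Ell2} {M : ℝ}
    (hM : ∀ r ∈ Set.Ico (0 : ℝ) 1, circleMean (powerSum a) r ≤ M) : ‖a‖ ≤ M :=
  (abs_le_of_sq_le_sq' (hasSum_le_of_sum_le a.hasSum_sq
    (sum_sq_coeff_le (hasSum_powerSum a) hM)) (nonneg_of_circleMean_le hM)).2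

/-- A holomorphic function with quadratic means at most `M` is the power series of a sequence in
`ℓ²`. -/
lemma Holo.exists_powerSum {f : 𝔻 → ℂ} (hf : Holo f) {M : ℝ}
    (hM : ∀ r ∈ Set.Ico (0 : ℝ) 1, circleMean f r ≤ M) : ∃ a : Ell2, powerSum a = f := by
  set b : ℕ → ℂ := fun n => (n.factorial : ℂ)⁻¹ * iteratedDeriv n (ext f) 0 with hb
  have hsum : ∀ z : 𝔻, HasSum (fun n => b n * (z : ℂ) ^ n) (f z) := fun z => by
    have := Complex.hasSum_taylorSeries_on_ball hf (mem_ball_zero_iff.2 z.norm_lt_one)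
    rw [ext_coe] at this
    have h : (fun n => b n * (z : ℂ) ^ n) = fun n =>
        (n.factorial : ℂ)⁻¹ • ((z : ℂ) - 0) ^ n • iteratedDeriv n (ext f) 0 := by
      ext n
      simp only [hb, sub_zero, smul_eq_mul]
      ring
    rwa [h]
  exact ⟨⟨b, memℓp_two (summable_of_sum_le (fun n => sq_nonneg _) (sum_sq_coeff_le hsum hM))⟩,
    funext fun z => (hsum z).tsum_eq⟩

lemma powerSum_mem (a : Ell2) : powerSum a ∈ H2 :=
  ⟨holo_powerSum a, ‖a‖, by rintro _ ⟨r, rfl⟩; exact circleMean_powerSum_le a r.2⟩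

lemma powerSum_add (a b : Ell2) : powerSum (a + b) = powerSum a + powerSum b := funext fun z => by
  refine HasSum.unique (hasSum_powerSum (a + b) z) ?_
  simpa [add_mul] using (hasSum_powerSum a z).add (hasSum_powerSum b z)

lemma powerSum_smul (c : ℂ) (a : Ell2) : powerSum (c • a) = c • powerSum a := funext fun z => by
  refine HasSum.unique (hasSum_powerSum (c • a) z) ?_
  simpa [mul_assoc] using (hasSum_powerSum a z).mul_left c

/-- Letting r → 1 in Parseval's identity. This makes `powerSumEquiv` isometric, so bounded operators
pass between `H2` and ℓ². -/
lemma hardyNorm_powerSum (a : Ell2) : hardyNorm (powerSum a) = ‖a‖ := by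
  have : Nonempty (Set.Ico (0 : ℝ) 1) := ⟨⟨0, by simp⟩⟩
  refine le_antisymm (ciSup_le fun r => circleMean_powerSum_le a r.2) ?_
  exact norm_le_of_circleMean_le fun r hr => le_ciSup (powerSum_mem a).2 ⟨r, hr⟩

/-- `ℓ²` as a linear parametrization of `H²` by Taylor coefficients. -/
def powerSumEquiv : Ell2 ≃ₗ[ℂ] H2 :=
  LinearEquiv.ofBijective
    { toFun := fun a => ⟨powerSum a, powerSum_mem a⟩
      map_add' := fun a b => Subtype.ext (powerSum_add a b)
      map_smul' := fun c a => Subtype.ext (powerSum_smul c a) }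
    ⟨(injective_iff_map_eq_zero _).2 fun a ha => by
      have h0 : powerSum a = 0 := congrArg Subtype.val ha
      refine norm_le_zero_iff.1 (norm_le_of_circleMean_le fun r hr => ?_)
      rw [h0]
      exact circleMean_le H2.zero_mem.1 hr fun z => by simp,
    fun f => by
      obtain ⟨hf, M, hM⟩ := f.2
      obtain ⟨a, ha⟩ := Holo.exists_powerSum hf (M := M) fun r hr => hM ⟨⟨r, hr⟩, rfl⟩
      exact ⟨a, Subtype.ext ha⟩⟩

lemma coe_powerSumEquiv (a : Ell2) : (powerSumEquiv a : 𝔻 → ℂ) = powerSum a := rfl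

lemma powerSum_injective : Function.Injective powerSum := fun _ _ h =>
  powerSumEquiv.injective (Subtype.ext h)

lemma exists_powerSum_of_mem {f : 𝔻 → ℂ} (hf : f ∈ H2) : ∃ a : Ell2, powerSum a = f :=
  ⟨powerSumEquiv.symm ⟨f, hf⟩, congrArg Subtype.val (powerSumEquiv.apply_symm_apply ⟨f, hf⟩)⟩

/-- The Taylor coefficients of the Szegő kernel. -/
def kernelSeq (w : 𝔻) : Ell2 :=
  ⟨fun n => conj (w : ℂ) ^ n, memℓp_two <| by
    have h : ‖(w : ℂ)‖ ^ 2 < 1 := pow_lt_one₀ (norm_nonneg _) w.norm_lt_one two_ne_zero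
    refine (summable_geometric_of_lt_one (sq_nonneg _) h).congr fun n => ?_
    rw [norm_pow, RCLike.norm_conj, ← pow_mul, ← pow_mul, mul_comm]⟩

lemma kernelSeq_apply (w : 𝔻) (n : ℕ) : kernelSeq w n = conj (w : ℂ) ^ n := rfl

/-- The reproducing property. -/
lemma inner_kernelSeq (w : 𝔻) (a : Ell2) : inner ℂ (kernelSeq w) a = powerSum a w := by
  refine (lp.hasSum_inner (kernelSeq w) a).unique ?_
  simpa [kernelSeq_apply] using hasSum_powerSum a w

lemma powerSum_kernelSeq (w : 𝔻) : powerSum (kernelSeq w) = fun z => szego z w := funext fun z => by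
  refine (hasSum_powerSum (kernelSeq w) z).unique ?_
  have hz : ‖(z : ℂ) * conj (w : ℂ)‖ < 1 := by
    rw [norm_mul, RCLike.norm_conj]
    nlinarith [z.norm_lt_one, w.norm_lt_one, norm_nonneg (z : ℂ), norm_nonneg (w : ℂ)]
  simpa [szego, kernelSeq_apply, mul_pow, mul_comm] using hasSum_geometric_of_norm_lt_one hz

lemma powerSumEquiv_kernelSeq (w : 𝔻) : powerSumEquiv (kernelSeq w) = kernelFun w :=
  Subtype.ext (powerSum_kernelSeq w)

lemma norm_powerSum_le (a : Ell2) (w : 𝔻) : ‖powerSum a w‖ ≤ ‖kernelSeq w‖ * ‖a‖ := by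
  rw [← inner_kernelSeq]
  exact norm_inner_le_norm _ _

/-! ### Composition and multiplication on `H²` -/

/-- A harmonic majorant of the squared modulus of a polynomial, controlled at a given point by the
`ℓ²`-norm of the coefficients. -/
lemma exists_majorant {c : ℂ} (hc : ‖c‖ < 1) (N : ℕ) (b : ℕ → ℂ) :
    ∃ Q : ℂ → ℂ, Differentiable ℂ Q ∧
      (∀ z, ‖z‖ ≤ 1 → ‖∑ n ∈ Finset.range N, b n * z ^ n‖ ^ 2 ≤ (Q z).re) ∧
      (Q c).re + ‖∑ n ∈ Finset.range N, b n * c ^ n‖ ^ 2 ≤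
        (2 + 4 * ‖c‖ ^ 2 / (1 - ‖c‖ ^ 2)) * ∑ n ∈ Finset.range N, ‖b n‖ ^ 2 := by
  induction N generalizing b with
  | zero => exact ⟨0, by fun_prop, by simp, by simp⟩
  | succ N ih =>
    -- Write p = b₀ + zq and expand |p|². On the disc |zq|² ≤ |q|², so a majorant of |q|² yields one
    -- of |p|².
    obtain ⟨Q, hQ, hle, hK⟩ := ih fun n => b (n + 1)
    set q : ℂ → ℂ := fun z => ∑ n ∈ Finset.range N, b (n + 1) * z ^ n with hq
    have hsum : ∀ z, ∑ n ∈ Finset.range (N + 1), b n * z ^ n = b 0 + z * q z := fun z => by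
      rw [Finset.sum_range_succ', hq, Finset.mul_sum, add_comm]
      simp only [pow_zero, mul_one]
      exact congrArg _ (Finset.sum_congr rfl fun n _ => by ring)
    have hsq : ∀ z, ‖b 0 + z * q z‖ ^ 2 =
        ‖b 0‖ ^ 2 + 2 * (conj (b 0) * (z * q z)).re + ‖z‖ ^ 2 * ‖q z‖ ^ 2 := fun z => by
      rw [← mul_pow, ← norm_mul]
      simp only [← Complex.normSq_eq_norm_sq, Complex.normSq_apply, Complex.add_re, Complex.add_im,
        Complex.mul_re, Complex.conj_re, Complex.conj_im]
      ring
    refine ⟨fun z => (‖b 0‖ ^ 2 : ℝ) + (2 : ℝ) * (conj (b 0) * (z * q z)) + Q z, by fun_prop, ?_, ?_⟩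
    · intro z hz
      rw [hsum, hsq]
      have h1 := hle z hz
      have h2 : ‖z‖ ^ 2 * ‖q z‖ ^ 2 ≤ 1 * ‖q z‖ ^ 2 :=
        mul_le_mul_of_nonneg_right (pow_le_one₀ (norm_nonneg _) hz) (sq_nonneg _)
      simp only [Complex.add_re, Complex.ofReal_re, Complex.re_ofReal_mul]
      linarith
    · rw [hsum, hsq, Finset.sum_range_succ' (fun n => ‖b n‖ ^ 2)]
      simp only [Complex.add_re, Complex.ofReal_re, Complex.re_ofReal_mul]
      have h1 : (conj (b 0) * (c * q c)).re ≤ ‖b 0‖ * (‖c‖ * ‖q c‖) := by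
        refine (Complex.re_le_norm _).trans ?_
        rw [norm_mul, norm_mul, RCLike.norm_conj]
      have hd : 0 < 1 - ‖c‖ ^ 2 := by nlinarith [norm_nonneg c]
      set x := ‖b 0‖
      set v := ‖q c‖
      set t := ‖c‖
      -- Completing the square. The extra |p(c)|² in the induction claim pays for the cross term:
      -- the hypothesis for q supplies a spare -v², of which t²v² is used up.
      have h2 : 4 * t * x * v ≤ (1 - t ^ 2) * v ^ 2 + 4 * t ^ 2 / (1 - t ^ 2) * x ^ 2 := by
        have : (1 - t ^ 2) * v ^ 2 + 4 * t ^ 2 / (1 - t ^ 2) * x ^ 2 - 4 * t * x * v =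
            ((1 - t ^ 2) * v - 2 * t * x) ^ 2 / (1 - t ^ 2) := by field_simp; ring
        have h3 := div_nonneg (sq_nonneg ((1 - t ^ 2) * v - 2 * t * x)) hd.le
        linarith
      rw [mul_add]
      nlinarith [hK]

lemma Holo.comp {f : 𝔻 → ℂ} (hf : Holo f) {φ : 𝔻 → 𝔻} (hφ : Holo fun z => (φ z : ℂ)) :
    Holo fun z => f (φ z) := by
  refine holo_of_eqOn (F := ext f ∘ ext fun z => (φ z : ℂ)) (DifferentiableOn.comp hf hφ ?_) ?_
  · intro z hz
    rw [ext_of_norm_lt _ (mem_ball_zero_iff.1 hz)]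
    exact mem_ball_zero_iff.2 (φ _).norm_lt_one
  · intro z
    rw [Function.comp_apply, ext_coe, ext_coe]

lemma Holo.mul {f g : 𝔻 → ℂ} (hf : Holo f) (hg : Holo g) : Holo fun z => f z * g z :=
  holo_of_eqOn (DifferentiableOn.mul hf hg) fun z => by simp [ext_coe]

lemma circleMean_mono {f g : 𝔻 → ℂ} (hf : Holo f) (hg : Holo g) (h : ∀ z, ‖f z‖ ≤ ‖g z‖) {r : ℝ}
    (hr : r ∈ Set.Ico (0 : ℝ) 1) : circleMean f r ≤ circleMean g r := by
  refine Real.sqrt_le_sqrt ?_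
  refine Real.circleAverage_mono (hf.circleIntegrable hr) (hg.circleIntegrable hr) fun z hz => ?_
  have hz1 := norm_lt_of_mem_sphere hr hz
  rw [ext_of_norm_lt f hz1, ext_of_norm_lt g hz1]
  exact pow_le_pow_left₀ (norm_nonneg _) (h _) 2

/-- The bound for the norm of a composition operator. -/
def compBound (φ : 𝔻 → 𝔻) : ℝ :=
  √(2 + 4 * ‖(φ 0 : ℂ)‖ ^ 2 / (1 - ‖(φ 0 : ℂ)‖ ^ 2))

lemma holo_sum_comp {φ : 𝔻 → 𝔻} (hφ : Holo fun z => (φ z : ℂ)) (b : ℕ → ℂ) (N : ℕ) :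
    Holo fun z => ∑ n ∈ Finset.range N, b n * (φ z : ℂ) ^ n := by
  refine holo_of_eqOn (F := fun z => ∑ n ∈ Finset.range N, b n *
    ext (fun z => (φ z : ℂ)) z ^ n) ?_ fun z => ?_
  · exact DifferentiableOn.fun_sum fun n _ => (DifferentiableOn.pow hφ n).const_mul _
  · rw [ext_coe]

/-- The majorant composed with φ is the real part of a holomorphic function, so its circle average
is its value at φ(0). -/
lemma circleMean_sum_comp_le {φ : 𝔻 → 𝔻} (hφ : Holo fun z => (φ z : ℂ)) (b : ℕ → ℂ) (N : ℕ)
    {r : ℝ} (hr : r ∈ Set.Ico (0 : ℝ) 1) :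
    circleMean (fun z => ∑ n ∈ Finset.range N, b n * (φ z : ℂ) ^ n) r ^ 2 ≤
      compBound φ ^ 2 * ∑ n ∈ Finset.range N, ‖b n‖ ^ 2 := by
  have hc := (φ 0).norm_lt_one
  obtain ⟨Q, hQ, hle, hK⟩ := exists_majorant hc N b
  have hd : 0 < 1 - ‖(φ 0 : ℂ)‖ ^ 2 := by nlinarith [norm_nonneg (φ 0 : ℂ)]
  rw [compBound, Real.sq_sqrt (by positivity)]
  refine le_trans ?_ ((le_add_of_nonneg_right (sq_nonneg _)).trans hK)
  set Φ : ℂ → ℂ := ext fun z => (φ z : ℂ) with hΦ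
  have hsub : Metric.closedBall (0 : ℂ) |r| ⊆ Metric.ball 0 1 := fun z hz => by
    rw [abs_of_nonneg hr.1] at hz
    exact mem_ball_zero_iff.2 ((mem_closedBall_zero_iff.1 hz).trans_lt hr.2)
  have hQΦ : DifferentiableOn ℂ (fun z => Q (Φ z)) (Metric.ball 0 1) :=
    hQ.comp_differentiableOn hφ
  have hmean : Real.circleAverage (fun z => Q (Φ z)) 0 r = Q (φ 0) := by
    rw [circleAverage_of_differentiable_on_off_countable Set.countable_empty
      (hQΦ.continuousOn.mono hsub)]
    · exact congrArg Q (ext_coe (fun z => (φ z : ℂ)) 0)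
    · intro z hz
      exact hQΦ.differentiableAt (Metric.isOpen_ball.mem_nhds
        (hsub (Metric.ball_subset_closedBall hz.1)))
  have hQi : ContinuousOn (fun z => Q (Φ z)) (Metric.sphere 0 r) :=
    hQΦ.continuousOn.mono fun z hz => hsub (Metric.sphere_subset_closedBall
      (by rwa [abs_of_nonneg hr.1]))
  have hre : Real.circleAverage (fun z => (Q (Φ z)).re) 0 r = (Q (φ 0)).re := by
    rw [← hmean]
    exact Complex.reCLM.circleAverage_comp_comm (hQi.circleIntegrable hr.1)
  have hh := holo_sum_comp hφ b N
  rw [circleMean, Real.sq_sqrt (Real.circleAverage_nonneg_of_nonneg fun z _ => sq_nonneg _), ← hre]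
  refine Real.circleAverage_mono (hh.circleIntegrable hr)
    (ContinuousOn.circleIntegrable hr.1 (Complex.continuous_re.comp_continuousOn hQi))
    fun z hz => ?_
  have hz1 := norm_lt_of_mem_sphere hr hz
  rw [hΦ, ext_of_norm_lt _ hz1, ext_of_norm_lt _ hz1]
  exact hle _ (φ _).norm_lt_one.le

/-- Littlewood's subordination principle, with a bound that is not sharp. -/
lemma circleMean_powerSum_comp_le {φ : 𝔻 → 𝔻} (hφ : Holo fun z => (φ z : ℂ)) (a : Ell2)
    {r : ℝ} (hr : r ∈ Set.Ico (0 : ℝ) 1) :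
    circleMean (fun z => powerSum a (φ z)) r ≤ compBound φ * ‖a‖ := by
  refine (abs_le_of_sq_le_sq' ?_ (mul_nonneg (Real.sqrt_nonneg _) (norm_nonneg a))).2
  set F : ℕ → 𝔻 → ℂ := fun N z => ∑ n ∈ Finset.range N, a n * (φ z : ℂ) ^ n with hF
  have hF_holo : ∀ N, Holo (F N) := holo_sum_comp hφ a
  -- the image of the circle is contained in a smaller disc
  obtain ⟨ρ, hρ1, hρ⟩ : ∃ ρ < 1, ∀ z ∈ Metric.sphere (0 : ℂ) 1,
      ‖ext (fun z => (φ z : ℂ)) (r * z)‖ ≤ ρ := by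
    obtain ⟨x, hx, hmax⟩ := (isCompact_sphere (0 : ℂ) 1).exists_isMaxOn ⟨1, by simp⟩
      (hφ.continuousOn_dilate hr).norm
    refine ⟨_, ?_, fun z hz => hmax hz⟩
    dsimp only
    rw [ext_of_norm_lt _ (norm_mul_lt_one hr hx)]
    exact (φ _).norm_lt_one
  have hρ0 : 0 ≤ ρ := (norm_nonneg _).trans (hρ 1 (by simp))
  have hgeo := summable_geometric_of_lt_one hρ0 hρ1
  have hlim : Filter.Tendsto (fun N => circleMean (F N) r ^ 2) Filter.atTop
      (𝓝 (circleMean (fun z => powerSum a (φ z)) r ^ 2)) := by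
    simp only [circleMean_sq]
    refine tendsto_circleAverage_sq (M := ∑' n, ‖a‖ * ρ ^ n)
      (Filter.Eventually.of_forall fun N => (hF_holo N).continuousOn_dilate hr)
      (Filter.Eventually.of_forall fun N z hz => ?_) (Filter.Eventually.of_forall fun t => ?_)
    · have h := hρ z hz
      rw [ext_of_norm_lt _ (norm_mul_lt_one hr hz)] at h ⊢
      refine (norm_sum_le _ _).trans (le_trans (Finset.sum_le_sum fun n _ => ?_)
        ((hgeo.mul_left ‖a‖).sum_le_tsum _ fun n _ => by positivity))
      rw [norm_mul, norm_pow]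
      gcongr
      exact lp.norm_apply_le_norm (by simp) a n
    · have hz := norm_mul_lt_one hr (circleMap_mem_sphere (0 : ℂ) zero_le_one t)
      simp only [ext_of_norm_lt _ hz]
      exact (hasSum_powerSum a _).tendsto_sum_nat.norm
  refine le_of_tendsto' hlim fun N => (circleMean_sum_comp_le hφ a N hr).trans ?_
  rw [mul_pow]
  exact mul_le_mul_of_nonneg_left (sum_le_hasSum _ (fun n _ => sq_nonneg _) a.hasSum_sq)
    (sq_nonneg _)

/-- Bounded operators on `ℓ²` that act on functions as weighted composition operators. -/
lemma exists_weightedComp {ψ : 𝔻 → ℂ} (hψ : ψ ∈ schurClass) {φ : 𝔻 → 𝔻}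
    (hφ : Holo fun z => (φ z : ℂ)) {C : ℝ}
    (hC : ∀ a : Ell2, ∀ r ∈ Set.Ico (0 : ℝ) 1,
      circleMean (fun z => powerSum a (φ z)) r ≤ C * ‖a‖) :
    ∃ T : Ell2 →L[ℂ] Ell2, (∀ a z, powerSum (T a) z = ψ z * powerSum a (φ z)) ∧
      ∀ a, ‖T a‖ ≤ C * ‖a‖ := by
  have hh : ∀ a, Holo fun z => powerSum a (φ z) := fun a => (holo_powerSum a).comp hφ
  have hle : ∀ a : Ell2, ∀ r ∈ Set.Ico (0 : ℝ) 1,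
      circleMean (fun z => ψ z * powerSum a (φ z)) r ≤ C * ‖a‖ := fun a r hr =>
    (circleMean_mono (hψ.1.mul (hh a)) (hh a) (fun z => by
      rw [norm_mul]
      exact mul_le_of_le_one_left (norm_nonneg _) (hψ.2 z)) hr).trans (hC a r hr)
  choose T hT using fun a => (hψ.1.mul (hh a)).exists_powerSum (hle a)
  have hbound : ∀ a, ‖T a‖ ≤ C * ‖a‖ := fun a =>
    norm_le_of_circleMean_le fun r hr => by rw [hT]; exact hle a r hr
  refine ⟨LinearMap.mkContinuous
    { toFun := T
      map_add' := fun a b => powerSum_injective ?_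
      map_smul' := fun c a => powerSum_injective ?_ } C hbound, fun a z => congrFun (hT a) z,
    hbound⟩
  · ext z
    simp [powerSum_add, hT, mul_add]
  · ext z
    simp [powerSum_smul, hT, mul_left_comm]

/-- Multiplication by a Schur function is a contraction. -/
lemma exists_mul {ψ : 𝔻 → ℂ} (hψ : ψ ∈ schurClass) :
    ∃ T : Ell2 →L[ℂ] Ell2, (∀ a z, powerSum (T a) z = ψ z * powerSum a z) ∧
      ∀ a, ‖T a‖ ≤ ‖a‖ := by
  have hid : Holo fun z => ((id z : 𝔻) : ℂ) := holo_of_eqOn differentiableOn_id fun z => rfl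
  -- `compBound` would give only √2 for the identity; the constant 1 is essential later.
  simpa using exists_weightedComp (C := 1) hψ hid fun a r hr => by
    simpa using circleMean_powerSum_le a hr

/-! ### Inner functions -/

lemma IsInner.mem_schurClass {θ : 𝔻 → ℂ} (hθ : IsInner θ) : θ ∈ schurClass :=
  ⟨hθ.holo, hθ.norm_le_one⟩

/-- Multiplication by an inner function does not decrease the norm of a function with absolutely
summable Taylor coefficients. -/
lemma IsInner.norm_le_of_summable {θ : 𝔻 → ℂ} (hθ : IsInner θ) {a b : Ell2}
    (ha : Summable fun n => ‖a n‖) (hb : ∀ z, powerSum b z = θ z * powerSum a z) :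
    ‖a‖ ≤ ‖b‖ := by
  refine (abs_le_of_sq_le_sq' ?_ (norm_nonneg b)).2
  set A : ℂ → ℂ := fun z => ∑' n, a n * z ^ n with hA
  have hterm : ∀ n, ∀ z ∈ Metric.closedBall (0 : ℂ) 1, ‖a n * z ^ n‖ ≤ ‖a n‖ := fun n z hz => by
    rw [norm_mul, norm_pow]
    exact mul_le_of_le_one_right (norm_nonneg _)
      (pow_le_one₀ (norm_nonneg _) (mem_closedBall_zero_iff.1 hz))
  have hAc : ContinuousOn A (Metric.closedBall 0 1) :=
    continuousOn_tsum (fun n => by fun_prop) ha hterm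
  have hAM : ∀ z ∈ Metric.closedBall (0 : ℂ) 1, ‖A z‖ ≤ ∑' n, ‖a n‖ := fun z hz =>
    tsum_of_norm_bounded ha.hasSum fun n => hterm n z hz
  have hnorm : ‖a‖ ^ 2 = Real.circleAverage (fun z => ‖A z‖ ^ 2) 0 1 :=
    a.hasSum_sq.unique (hasSum_sq_circleAverage ha)
  have hr : ∀ᶠ r : ℝ in 𝓝[<] 1, r ∈ Set.Ico (0 : ℝ) 1 := by
    filter_upwards [Ioo_mem_nhdsLT (zero_lt_one' ℝ)] with r hr using ⟨hr.1.le, hr.2⟩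
  have hval : ∀ z : ℂ, ‖z‖ < 1 → ext (powerSum b) z = ext θ z * A z := fun z hz => by
    rw [ext_of_norm_lt _ hz, ext_of_norm_lt _ hz, hb]
    rfl
  -- As A is continuous up to the circle, |θA| has radial limits |A| almost everywhere; the means of
  -- θA, all at most ‖b‖, thus tend to ‖a‖.
  have hlim : Filter.Tendsto (fun r : ℝ => circleMean (powerSum b) r ^ 2) (𝓝[<] 1)
      (𝓝 (‖a‖ ^ 2)) := by
    simp only [circleMean_sq, hnorm]
    refine tendsto_circleAverage_sq (M := ∑' n, ‖a n‖) ?_ ?_ ?_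
    · filter_upwards [hr] with r hr using (holo_powerSum b).continuousOn_dilate hr
    · filter_upwards [hr] with r hr z hz
      have h1 := norm_mul_lt_one hr hz
      rw [hval _ h1, norm_mul, ext_of_norm_lt _ h1]
      exact (mul_le_of_le_one_left (norm_nonneg _) (hθ.norm_le_one _)).trans
        (hAM _ (mem_closedBall_zero_iff.2 h1.le))
    · filter_upwards [hθ.radial_limit] with t ⟨c, hc, ht⟩
      have hz := circleMap_mem_sphere (0 : ℂ) zero_le_one t
      have h1 : Filter.Tendsto (fun r : ℝ => A (r * circleMap 0 1 t)) (𝓝[<] 1)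
          (𝓝 (A (circleMap 0 1 t))) := by
        refine (hAc _ (Metric.sphere_subset_closedBall hz)).tendsto.comp
          (tendsto_nhdsWithin_iff.2 ⟨?_, ?_⟩)
        · have : Continuous fun r : ℝ => (r : ℂ) * circleMap 0 1 t := by fun_prop
          simpa using (this.tendsto 1).mono_left nhdsWithin_le_nhds
        · filter_upwards [hr] with r hr using
            mem_closedBall_zero_iff.2 (norm_mul_lt_one hr hz).le
      have h2 := (ht.mul h1).norm
      rw [norm_mul, hc, one_mul] at h2
      refine h2.congr' ?_
      filter_upwards [hr] with r hr
      rw [hval _ (norm_mul_lt_one hr hz)]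
      simp [circleMap]
  refine le_of_tendsto hlim ?_
  filter_upwards [hr] with r hr
  exact pow_le_pow_left₀ (circleMean_nonneg _ _) (circleMean_powerSum_le b hr) 2

/-- Multiplication by an inner function does not decrease the norm. -/
lemma IsInner.norm_le {θ : 𝔻 → ℂ} (hθ : IsInner θ) {a b : Ell2}
    (hb : ∀ z, powerSum b z = θ z * powerSum a z) : ‖a‖ ≤ ‖b‖ := by
  obtain ⟨T, hT, -⟩ := exists_mul hθ.mem_schurClass
  obtain rfl : T a = b := powerSum_injective (funext fun z => by rw [hT, hb])
  -- Finitely supported sequences are dense, and the inequality is a closed condition.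
  have hclosed : IsClosed {a : Ell2 | ‖a‖ ≤ ‖T a‖} :=
    isClosed_le continuous_norm T.continuous.norm
  refine hclosed.mem_of_tendsto (lp.hasSum_single (by simp) a) (Filter.Eventually.of_forall
    fun s => hθ.norm_le_of_summable (summable_of_hasFiniteSupport (s.finite_toSet.subset ?_)) (hT _))
  intro n hn
  by_contra h
  refine hn (norm_eq_zero.2 ?_)
  refine (congrFun (lp.coeFn_sum (fun i => lp.single 2 i (a i)) s) n).trans
    ((Finset.sum_apply n s _).trans (Finset.sum_eq_zero fun i hi => ?_))
  have hni : n ≠ i := fun hni => h (by rw [hni]; exact hi)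
  exact lp.single_apply_ne (E := fun _ : ℕ => ℂ) 2 i (a i) hni

/-- Otherwise multiplication by θ would send K_0 = 1 to 0 without decreasing its norm. -/
lemma IsInner.exists_ne_zero {θ : 𝔻 → ℂ} (hθ : IsInner θ) : ∃ z, θ z ≠ 0 := by
  by_contra! h
  have h1 : ‖kernelSeq 0‖ ≤ ‖(0 : Ell2)‖ := hθ.norm_le fun z => by
    rw [h, zero_mul]
    simp [powerSum]
  have h2 := congrFun (powerSum_kernelSeq 0) 0
  rw [norm_le_zero_iff.1 (h1.trans_eq norm_zero)] at h2
  simp [powerSum, szego] at h2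

/-- An identity between holomorphic functions can be checked where `θ ≠ 0`. -/
lemma IsInner.eq_of_eq_of_ne_zero {θ : 𝔻 → ℂ} (hθ : IsInner θ) {f g : 𝔻 → ℂ} (hf : Holo f)
    (hg : Holo g) (h : ∀ z, θ z ≠ 0 → f z = g z) : f = g := by
  have han : ∀ {u : 𝔻 → ℂ}, Holo u → AnalyticOnNhd ℂ (ext u) (Metric.ball 0 1) := fun hu =>
    DifferentiableOn.analyticOnNhd hu Metric.isOpen_ball
  -- θ(f - g) vanishes everywhere, and analytic functions on a connected set have no zero divisors.
  have hmul : ∀ z ∈ Metric.ball (0 : ℂ) 1, ext θ z * (ext f - ext g) z = 0 := fun z hz => by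
    have hz := mem_ball_zero_iff.1 hz
    rw [Pi.sub_apply, ext_of_norm_lt _ hz, ext_of_norm_lt _ hz, ext_of_norm_lt _ hz]
    by_cases h1 : θ (Complex.UnitDisc.mk z hz) = 0
    · rw [h1, zero_mul]
    · rw [h _ h1, sub_self, mul_zero]
  rcases AnalyticOnNhd.eq_zero_or_eq_zero_of_mul_eq_zero (han hθ.holo) ((han hf).sub (han hg)) hmul
    (convex_ball (0 : ℂ) 1).isPreconnected with h0 | h0
  · obtain ⟨z, hz⟩ := hθ.exists_ne_zero
    exact absurd (by rw [← ext_coe θ, h0 _ (mem_ball_zero_iff.2 z.norm_lt_one)]) hz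
  · ext z
    have := h0 _ (mem_ball_zero_iff.2 z.norm_lt_one)
    rwa [Pi.sub_apply, ext_coe, ext_coe, sub_eq_zero] at this

/-- If `θ h` is bounded by one for an inner function `θ` and `h ∈ H²`, then so is `h`. -/
lemma IsInner.norm_le_one_of_mul {θ : 𝔻 → ℂ} (hθ : IsInner θ) {h : 𝔻 → ℂ} (hh : h ∈ H2)
    (hle : ∀ z, ‖θ z * h z‖ ≤ 1) (w : 𝔻) : ‖h w‖ ≤ 1 := by
  obtain ⟨b, rfl⟩ := exists_powerSum_of_mem hh
  have hw : 0 < 1 - ‖(w : ℂ)‖ := sub_pos.2 w.norm_lt_one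
  -- The factor scales the kernel to modulus at most one, so that `exists_mul` applies; it cancels
  -- at the end.
  set δ : ℂ := ((1 - ‖(w : ℂ)‖ : ℝ) : ℂ) with hδ
  have hδ0 : δ ≠ 0 := Complex.ofReal_ne_zero.2 hw.ne'
  -- a multiple of the kernel function is a Schur function
  have hk : (fun z => δ * szego z w) ∈ schurClass := by
    refine ⟨(szego_mem w).1.smul δ, fun z => ?_⟩
    rw [norm_mul, hδ, Complex.norm_real, Real.norm_of_nonneg hw.le, szego, norm_inv,
      ← div_eq_mul_inv]
    refine div_le_one_of_le₀ ?_ (norm_nonneg _)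
    have h := norm_sub_norm_le (1 : ℂ) ((z : ℂ) * conj (w : ℂ))
    rw [norm_one, norm_mul, RCLike.norm_conj] at h
    nlinarith [z.norm_lt_one, norm_nonneg (w : ℂ)]
  obtain ⟨S, hS, -⟩ := exists_mul hk
  obtain ⟨R, hR, hRle⟩ := exists_mul (ψ := fun z => θ z * powerSum b z)
    ⟨hθ.holo.mul (holo_powerSum b), hle⟩
  -- θ·(δK_w h) = (θh)·δK_w, and multiplication by θh is a contraction: ‖δK_w h‖ ≤ ‖δK_w‖.
  -- Evaluating at w gives |δ| K(w,w) |h(w)| ≤ |δ| ‖K_w‖², where K(w,w) = ‖K_w‖².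
  have h1 : ‖S b‖ ≤ ‖R (δ • kernelSeq w)‖ := hθ.norm_le fun z => by
    rw [hR, hS, powerSum_smul, Pi.smul_apply, powerSum_kernelSeq, smul_eq_mul]
    ring
  have h2 := (norm_powerSum_le (S b) w).trans
    (mul_le_mul_of_nonneg_left (h1.trans (hRle _)) (norm_nonneg _))
  have h3 : szego w w = ((‖kernelSeq w‖ ^ 2 : ℝ) : ℂ) := by
    rw [← congrFun (powerSum_kernelSeq w) w, ← inner_kernelSeq, inner_self_eq_norm_sq_to_K]
    simp
  have hpos : 0 < ‖kernelSeq w‖ ^ 2 := by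
    refine (sq_nonneg _).lt_of_ne fun h0 => ?_
    rw [← h0, Complex.ofReal_zero] at h3
    exact inv_ne_zero (one_sub_ne_zero w w) h3
  have h4 : ‖szego w w‖ = ‖kernelSeq w‖ ^ 2 := by
    rw [h3, Complex.norm_real, Real.norm_of_nonneg hpos.le]
  rw [hS, norm_mul, norm_mul, norm_smul, h4] at h2
  refine le_of_mul_le_mul_left ?_ (mul_pos (norm_pos_iff.2 hδ0) hpos)
  linarith

/-! ### The three implications -/

lemma one_mem_H2 : (1 : 𝔻 → ℂ) ∈ H2 :=
  have h : Holo 1 := holo_of_eqOn (differentiableOn_const (1 : ℂ)) fun _ => rfl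
  ⟨h, 1, by rintro _ ⟨r, rfl⟩; exact circleMean_le h r.2 fun z => by simp⟩

/-- If `C_φ` maps `θ H²` into itself, then `(θ ∘ φ) / θ` is a Schur function. -/
lemma exists_schur_of_image_subset {φ : 𝔻 → 𝔻} {θ : 𝔻 → ℂ} (hθ : IsInner θ)
    (h : compOp φ '' mulH2 θ ⊆ mulH2 θ) :
    ∃ ψ ∈ schurClass, ∀ z, θ z ≠ 0 → ψ z = θ (φ z) / θ z := by
  obtain ⟨g, hg, hgθ⟩ := h ⟨θ, ⟨1, one_mem_H2, mul_one θ⟩, rfl⟩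
  have hmul : ∀ z, θ z * g z = θ (φ z) := fun z => congrFun hgθ z
  refine ⟨g, ⟨hg.1, hθ.norm_le_one_of_mul hg fun z => ?_⟩, fun z hz => ?_⟩
  · rw [hmul]
    exact hθ.norm_le_one _
  · rw [eq_div_iff hz, mul_comm, hmul]

/-- If `(θ ∘ φ) / θ` is a Schur function, then the operator on kernel functions is the adjoint of a
weighted composition operator. -/
lemma exists_boundedOp_of_schur {φ : 𝔻 → 𝔻} (hφ : Holo fun z => (φ z : ℂ)) {θ : 𝔻 → ℂ}
    (hθ : IsInner θ) {ψ : 𝔻 → ℂ} (hψ : ψ ∈ schurClass)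
    (h : ∀ z, θ z ≠ 0 → ψ z = θ (φ z) / θ z) :
    ∃ A : H2 →ₗ[ℂ] H2, IsBoundedOp A ∧
      ∀ w, A (conj (θ w) • kernelFun w) = conj (θ (φ w)) • kernelFun (φ w) := by
  -- ψθ = θ∘φ holds at the zeros of θ too.
  have hmul := hθ.eq_of_eq_of_ne_zero (hψ.1.mul hθ.holo) (hθ.holo.comp hφ) fun z hz => by
    rw [h z hz, div_mul_cancel₀ _ hz]
  obtain ⟨T, hT, -⟩ := exists_weightedComp hψ hφ fun a r hr =>
    circleMean_powerSum_comp_le hφ a hr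
  set S := ContinuousLinearMap.adjoint T with hS
  have hker : ∀ w, S (kernelSeq w) = conj (ψ w) • kernelSeq (φ w) := fun w => by
    refine ext_inner_right ℂ fun a => ?_
    rw [hS, ContinuousLinearMap.adjoint_inner_left, inner_kernelSeq, hT, inner_smul_left,
      inner_kernelSeq, RingHomCompTriple.comp_apply, RingHom.id_apply]
  refine ⟨powerSumEquiv.toLinearMap ∘ₗ S.toLinearMap ∘ₗ powerSumEquiv.symm.toLinearMap,
    ⟨‖S‖, fun f => ?_⟩, fun w => ?_⟩
  · obtain ⟨a, rfl⟩ := powerSumEquiv.surjective f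
    simp only [LinearMap.comp_apply, LinearEquiv.coe_coe, LinearEquiv.symm_apply_apply,
      ContinuousLinearMap.coe_coe, coe_powerSumEquiv, hardyNorm_powerSum]
    exact S.le_opNorm a
  · simp only [LinearMap.comp_apply, LinearEquiv.coe_coe, ← powerSumEquiv_kernelSeq, ← map_smul,
      LinearEquiv.symm_apply_apply, ContinuousLinearMap.coe_coe, EmbeddingLike.apply_eq_iff_eq]
    rw [map_smul, hker, smul_smul, ← map_mul, mul_comm, congrFun hmul w]

/-- If the operator on kernel functions is bounded, its adjoint divides `C_φ (θ g)` by `θ`. -/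
lemma image_subset_of_exists_boundedOp {φ : 𝔻 → 𝔻} {θ : 𝔻 → ℂ} {A : H2 →ₗ[ℂ] H2}
    (hA : IsBoundedOp A)
    (h : ∀ w, A (conj (θ w) • kernelFun w) = conj (θ (φ w)) • kernelFun (φ w)) :
    compOp φ '' mulH2 θ ⊆ mulH2 θ := by
  obtain ⟨C, hC⟩ := hA
  set S : Ell2 →L[ℂ] Ell2 := LinearMap.mkContinuous
    (powerSumEquiv.symm.toLinearMap ∘ₗ A ∘ₗ powerSumEquiv.toLinearMap) C fun a => by
      have := hC (powerSumEquiv a)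
      rwa [coe_powerSumEquiv, hardyNorm_powerSum,
        ← powerSumEquiv.apply_symm_apply (A (powerSumEquiv a)), coe_powerSumEquiv,
        hardyNorm_powerSum] at this
  have hS : ∀ w, S (conj (θ w) • kernelSeq w) = conj (θ (φ w)) • kernelSeq (φ w) := fun w =>
    powerSumEquiv.injective <| by
      simp [S, powerSumEquiv_kernelSeq, ← h w]
  rintro _ ⟨_, ⟨g, hg, rfl⟩, rfl⟩
  obtain ⟨a, rfl⟩ := exists_powerSum_of_mem hg
  refine ⟨powerSum (ContinuousLinearMap.adjoint S a), powerSum_mem _, funext fun w => ?_⟩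
  -- By the reproducing property this reads θ(w)(S*a)(w) = θ(φ(w)) a(φ(w)); nothing is divided by θ,
  -- so its zeros do no harm.
  have h1 := ContinuousLinearMap.adjoint_inner_right S (conj (θ w) • kernelSeq w) a
  rw [hS, inner_smul_left, inner_smul_left, inner_kernelSeq, inner_kernelSeq,
    RingHomCompTriple.comp_apply, RingHomCompTriple.comp_apply, RingHom.id_apply,
    RingHom.id_apply] at h1
  exact h1

end HardyDisc

end

theorem proposition2p4 (φ : Complex.UnitDisc → Complex.UnitDisc)
    (hφ : HardyDisc.Holo (fun z => (φ z : ℂ)))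
    (θ : Complex.UnitDisc → ℂ) (hθ : HardyDisc.IsInner θ) :
    List.TFAE [
      HardyDisc.compOp φ '' HardyDisc.mulH2 θ ⊆ HardyDisc.mulH2 θ,
      ∃ A : HardyDisc.H2 →ₗ[ℂ] HardyDisc.H2, HardyDisc.IsBoundedOp A ∧
        ∀ w : Complex.UnitDisc, A (conj (θ w) • HardyDisc.kernelFun w) =
          conj (θ (φ w)) • HardyDisc.kernelFun (φ w),
      ∃ ψ ∈ HardyDisc.schurClass, ∀ z : Complex.UnitDisc, θ z ≠ 0 → ψ z = θ (φ z) / θ z] := by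
  tfae_have 1 → 3 := HardyDisc.exists_schur_of_image_subset hθ
  tfae_have 3 → 2 := fun ⟨_, hψ, h⟩ => HardyDisc.exists_boundedOp_of_schur hφ hθ hψ h
  tfae_have 2 → 1 := fun ⟨_, hA, h⟩ => HardyDisc.image_subset_of_exists_boundedOp hA h
  tfae_finish
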